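/- Let $\alpha,\beta,\xi$ be real analytic functions on a neighbourhood $N_0$ of $0\in\mathbb R$ with $\alpha(x)>0$ for $x\in N_0$, $x\beta(x)>0$ for $x\in N_0\setminus\{0\}$, and, as normalization of the linear part, $\alpha(0)\beta'(0)=1$. Consider the planar system $$\dot x=-\alpha(x)\,y,\qquad \dot y=\beta(x)+\xi(x)\,y^2,$$ and, for $x$ near $0$, define $X=X(x)$, with the same sign as $x$, by $$\tfrac12X^2=\int_0^x\frac{\beta(s)}{\alpha(s)}\,e^{2\int_0^s\frac{\xi(t)}{\alpha(t)}\,dt}\,ds .$$ The origin is called an isochronous center if some neighbourhood of it is, apart from the origin, a union of nonconstant periodic orbits that all have the same minimal period. Then the origin is an isochronous center of the system if and only if there is a function $h$, odd and of class $C^1$ in a neighbourhood of $0$, such that for all $x$ near $0$ $$\alpha(x)\beta'(x)+\xi(x)\beta(x)=\frac{1+h(X)-h'(X)\,X}{(1+h(X))^3},\qquad X=X(x). \tag{$*$}$$ Moreover, every odd $C^1$ function $h$ near $0$ that satisfies $(*)$ is the Urabe function of the system, that is, $\beta(x)\,e^{\int_0^x\xi(t)/\alpha(t)\,dt}=\dfrac{X}{1+h(X)}$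 for all $x$ near $0$; and for every such $h$, $$\alpha\beta'+\xi\beta\equiv1\ \text{ near } 0\iff h\equiv0\ \text{ near } 0 .$$ -/

import Mathlib

open Filter Topology

noncomputable section

namespace UrabeIsochrone

/-- The planar autonomous vector field `V`, considered on `Ω ⊆ ℝ²`, has an isochronous center at
the equilibrium `p`: some neighbourhood `U ⊆ Ω` of `p` is, apart from `p`, a union of nonconstant
periodic orbits, all of which have the same minimal period `T`. -/
def IsIsochronousCenter (V : ℝ × ℝ → ℝ × ℝ) (Ω : Set (ℝ × ℝ)) (p : ℝ × ℝ) : Prop :=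
  V p = 0 ∧ ∃ T : ℝ, ∃ U ∈ 𝓝 p, U ⊆ Ω ∧ ∀ q ∈ U, q ≠ p →
    ∃ γ : ℝ → ℝ × ℝ, γ 0 = q ∧ (∀ t, γ t ∈ U) ∧ IsIntegralCurve γ (fun _ => V) ∧
      IsLeast {S : ℝ | 0 < S ∧ Function.Periodic γ S} T

/-- The vector field of the system `x' = -α(x) y`, `y' = β(x) + ξ(x) y²`. -/
def field (α β ξ : ℝ → ℝ) (p : ℝ × ℝ) : ℝ × ℝ :=
  (-(α p.1) * p.2, β p.1 + ξ p.1 * p.2 ^ 2)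

/-- The function `X(x)`, of the sign of `x`, with
`X² / 2 = ∫₀ˣ (β(s)/α(s)) exp (2 ∫₀ˢ ξ(t)/α(t) dt) ds`. -/
def bigX (α β ξ : ℝ → ℝ) (x : ℝ) : ℝ :=
  Real.sign x *
    √(2 * ∫ s in (0 : ℝ)..x, β s / α s * Real.exp (2 * ∫ t in (0 : ℝ)..s, ξ t / α t))

/-- `h` is of class `C¹` and odd in a neighbourhood of `0`. -/
def IsOddC1 (h : ℝ → ℝ) : Prop :=
  ContDiffAt ℝ 1 h 0 ∧ ∀ᶠ X in 𝓝 (0 : ℝ), h (-X) = -h X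

/-- `h` is the Urabe function of the system. In the coordinate
`u = ∫₀ˣ (1/α(s)) exp (∫₀ˢ ξ/α) ds` the system becomes `u'' + g(u) = 0` with
`g(u) = β(x) exp (∫₀ˣ ξ/α)`, and the requirement is `g(u) = X / (1 + h(X))` near `0`. -/
def IsUrabeFunction (α β ξ h : ℝ → ℝ) : Prop :=
  ∀ᶠ x in 𝓝 (0 : ℝ), β x * Real.exp (∫ t in (0 : ℝ)..x, ξ t / α t) =
    bigX α β ξ x / (1 + h (bigX α β ξ x))

/-- `α β' + ξ β = (1 + h(X) - h'(X) X) / (1 + h(X))³` for all `x` near `0`, with `X = X(x)`. -/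
def UrabeIdentity (α β ξ h : ℝ → ℝ) : Prop :=
  ∀ᶠ x in 𝓝 (0 : ℝ), α x * deriv β x + ξ x * β x =
    (1 + h (bigX α β ξ x) - deriv h (bigX α β ξ x) * bigX α β ξ x) /
      (1 + h (bigX α β ξ x)) ^ 3

end UrabeIsochrone

end

/-! Write F = ∫₀ˣ ξ/α, g = β e^F and v = e^F y. Then X is analytic with X = Q g, where Q is
analytic, Q(0) = 1, and X' = e^F/(α Q) (`exists_normal_form`). In the coordinates (X, v) the system
reads X' = -v/Q, v' = X/Q, a rotation along the circles X² + v² = r² with angular speed 1/Q. If Y is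
the local inverse of X, the circle of radius r is therefore an orbit of minimal period ∫₀^{2π} Q(Y(r
cos θ)) dθ (`exists_orbit`). The shift θ ↦ θ + π shows that only the even part of Q ∘ Y contributes
to this integral. An even analytic function whose averages over all small circles vanish is zero
(`eventually_eq_zero_of_integral_comp_cos`), so the period is constant exactly when the even part of
Q ∘ Y is constantly 1, that is, when Q ∘ Y - 1 is odd. Finally g = X/Q says that Q ∘ Y - 1 is the
Urabe function, and it is the only one vanishing at 0. Differentiating g = X/(1 + h) gives (*).
Conversely (*) integrates back, because it makes g² - (X/(1 + h))² constant
(`isUrabeFunction_of_urabeIdentity`). -/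

namespace UrabeIsochrone

/-! ### Analytic primitives and difference quotients. -/

/-- A real analytic function has an analytic primitive near the base point. -/
theorem exists_analyticAt_primitive {f : ℝ → ℝ} (hf : AnalyticAt ℝ f 0) :
    ∃ G : ℝ → ℝ, AnalyticAt ℝ G 0 ∧ ∀ᶠ x in 𝓝 (0 : ℝ), HasDerivAt G (f x) x := by
  obtain ⟨p, R, hp⟩ := hf
  obtain ⟨r, hr0, hrR⟩ := ENNReal.lt_iff_exists_nnreal_btwn.1 hp.r_pos
  have hr0' : 0 < (r : ℝ) := by exact_mod_cast hr0
  have hrp : (r : ENNReal) < p.radius := hrR.trans_le hp.r_le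
  have hsum : Summable fun n => ‖p n‖ * (r : ℝ) ^ n := p.summable_norm_mul_pow hrp
  have hcoeff : ∀ n, |p.coeff n| = ‖p n‖ := fun n => p.norm_apply_eq_norm_coef.symm ▸ rfl
  -- At n = 0 the division by zero gives the coefficient 0, so the truncated `n - 1` does no harm.
  set c : ℕ → ℝ := fun n => p.coeff (n - 1) / n with hc
  set q := FormalMultilinearSeries.ofScalars ℝ c with hq
  have hqr : (r : ENNReal) ≤ q.radius := by
    refine q.le_radius_of_summable_norm ?_
    rw [← summable_nat_add_iff 1]
    refine Summable.of_nonneg_of_le (fun n => by positivity) (fun n => ?_) (hsum.mul_left (r : ℝ))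
    rw [hq, FormalMultilinearSeries.ofScalars_norm]
    simp only [hc, Nat.add_sub_cancel, Real.norm_eq_abs, abs_div, hcoeff, pow_succ]
    have h1 : ‖p n‖ / |((n + 1 : ℕ) : ℝ)| ≤ ‖p n‖ := by
      refine div_le_self (norm_nonneg _) ?_
      rw [Nat.abs_cast]; push_cast; linarith [(n.cast_nonneg : (0 : ℝ) ≤ n)]
    calc _ ≤ ‖p n‖ * ((r : ℝ) ^ n * r) := by gcongr
      _ = _ := by ring
  have hqpos : 0 < q.radius := lt_of_lt_of_le hr0 hqr
  refine ⟨q.sum, (q.hasFPowerSeriesOnBall hqpos).analyticAt, ?_⟩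
  have hball : Metric.ball (0 : ℝ) r ∈ 𝓝 (0 : ℝ) := Metric.ball_mem_nhds _ hr0'
  have hqs : ∀ x ∈ Metric.ball (0 : ℝ) r, HasSum (fun n => p.coeff n / (n + 1) * x ^ (n + 1))
      (q.sum x) := by
    intro x hx
    have hx' : x ∈ Metric.eball (0 : ℝ) q.radius := by
      rw [Metric.mem_eball]
      refine lt_of_lt_of_le ?_ hqr
      rw [Metric.mem_ball] at hx
      rw [edist_dist, ENNReal.ofReal_lt_coe_iff dist_nonneg]
      exact hx
    have := q.hasSum hx'
    have h2 := (hasSum_nat_add_iff' 1).2 this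
    simp only [hq, FormalMultilinearSeries.ofScalars_apply_eq, hc] at h2
    simpa using h2
  have hfs : ∀ x ∈ Metric.ball (0 : ℝ) r, HasSum (fun n => p.coeff n * x ^ n) (f x) := by
    intro x hx
    have hx' : x ∈ Metric.eball (0 : ℝ) R := by
      rw [Metric.mem_eball]
      refine lt_trans ?_ hrR
      rw [Metric.mem_ball] at hx
      rw [edist_dist, ENNReal.ofReal_lt_coe_iff dist_nonneg]
      exact hx
    have := hp.hasSum hx'
    simpa [mul_comm] using this
  filter_upwards [hball] with x hx
  have key := hasDerivAt_tsum_of_isPreconnected (g := fun n x => p.coeff n / (n + 1) * x ^ (n + 1))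
    (g' := fun n x => p.coeff n * x ^ n) hsum Metric.isOpen_ball
    (convex_ball (0 : ℝ) r).isPreconnected (fun n y _ => ?_) (fun n y hy => ?_) hx
    (hqs x hx).summable hx
  · rw [(hfs x hx).tsum_eq] at key
    refine key.congr_of_eventuallyEq ?_
    filter_upwards [Metric.isOpen_ball.mem_nhds hx] with y hy
    exact (hqs y hy).tsum_eq.symm
  · have := (hasDerivAt_pow (n + 1) y).const_mul (p.coeff n / (n + 1))
    have hn : ((n : ℝ) + 1) ≠ 0 := by positivity
    have he : p.coeff n / (n + 1) * (((n + 1 : ℕ) : ℝ) * y ^ (n + 1 - 1)) = p.coeff n * y ^ n := by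
      rw [Nat.add_sub_cancel]; push_cast; field_simp
    exact he ▸ this
  · rw [norm_mul, Real.norm_eq_abs, hcoeff, norm_pow]
    have : ‖y‖ ≤ r := by simpa using (Metric.mem_ball.1 hy).le
    gcongr

/-- The integral from `0` of a function analytic at `0` is analytic at `0`. -/
theorem analyticAt_integral {f : ℝ → ℝ} (hf : AnalyticAt ℝ f 0) :
    AnalyticAt ℝ (fun x => ∫ t in (0 : ℝ)..x, f t) 0 ∧
      ∀ᶠ x in 𝓝 (0 : ℝ), HasDerivAt (fun x => ∫ t in (0 : ℝ)..x, f t) (f x) x := by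
  obtain ⟨G, hG, hd⟩ := exists_analyticAt_primitive hf
  obtain ⟨ε, hε, hball⟩ := Metric.eventually_nhds_iff_ball.1 (hd.and hf.eventually_analyticAt)
  have heq : ∀ x ∈ Metric.ball (0 : ℝ) ε, ∫ t in (0 : ℝ)..x, f t = G x - G 0 := by
    intro x hx
    have hsub : Set.uIcc 0 x ⊆ Metric.ball (0 : ℝ) ε :=
      (convex_ball (0 : ℝ) ε).ordConnected.uIcc_subset (Metric.mem_ball_self hε) hx
    refine intervalIntegral.integral_eq_sub_of_hasDerivAt (fun t ht => (hball t (hsub ht)).1) ?_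
    exact ContinuousOn.intervalIntegrable fun t ht =>
      (hball t (hsub ht)).2.continuousAt.continuousWithinAt
  have hev : ∀ x ∈ Metric.ball (0 : ℝ) ε,
      (fun x => ∫ t in (0 : ℝ)..x, f t) =ᶠ[𝓝 x] fun x => G x - G 0 := fun x hx => by
    filter_upwards [Metric.isOpen_ball.mem_nhds hx] with y hy using heq y hy
  refine ⟨(hG.sub analyticAt_const).congr (hev 0 (Metric.mem_ball_self hε)).symm, ?_⟩
  filter_upwards [Metric.ball_mem_nhds (0 : ℝ) hε] with x hx
  exact ((hball x hx).1.sub_const _).congr_of_eventuallyEq (hev x hx)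

/-- The difference quotient at `0` of a function analytic at `0` is analytic at `0`. -/
theorem analyticAt_dslope {f : ℝ → ℝ} (hf : AnalyticAt ℝ f 0) :
    AnalyticAt ℝ (dslope f 0) 0 := by
  obtain ⟨p, hp⟩ := hf
  exact (HasFPowerSeriesAt.has_fpower_series_dslope_fslope hp).analyticAt

/-! ### Analyticity of X and the factorization X = Q g. -/

/-- The exponent `∫₀ˣ ξ/α`. -/
noncomputable def expo (α ξ : ℝ → ℝ) (x : ℝ) : ℝ := ∫ t in (0 : ℝ)..x, ξ t / α t

theorem expo_zero (α ξ : ℝ → ℝ) : expo α ξ 0 = 0 := by simp [expo]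

theorem bigX_zero (α β ξ : ℝ → ℝ) : bigX α β ξ 0 = 0 := by simp [bigX]

/-- The function x β(x) has a local minimum at 0, and its derivative there is β(0). -/
theorem eq_zero_of_mul_pos {β : ℝ → ℝ} (hβ : AnalyticAt ℝ β 0)
    (hpos : ∀ᶠ x in 𝓝 (0 : ℝ), x ≠ 0 → 0 < x * β x) : β 0 = 0 := by
  have h1 : HasDerivAt (fun x => x * β x) (β 0) 0 := by
    exact ((hasDerivAt_id' (0 : ℝ)).fun_mul hβ.differentiableAt.hasDerivAt).congr_deriv (by simp)
  refine IsLocalMin.hasDerivAt_eq_zero (f := fun x => x * β x) ?_ h1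
  filter_upwards [hpos] with x hx
  rcases eq_or_ne x 0 with rfl | h
  · exact le_rfl
  · simpa using (hx h).le

/-- A function with derivative `x c(x)` that vanishes at `0` is `x² w(x)` with `w(0) = c(0)/2`. -/
theorem exists_eq_sq_mul {W c : ℝ → ℝ} (hW : AnalyticAt ℝ W 0) (hc : ContinuousAt c 0)
    (hW0 : W 0 = 0) (hd : ∀ᶠ x in 𝓝 (0 : ℝ), HasDerivAt W (x * c x) x) :
    ∃ w : ℝ → ℝ, AnalyticAt ℝ w 0 ∧ w 0 = c 0 / 2 ∧ ∀ x, W x = x ^ 2 * w x := by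
  have hW1 : dslope W 0 0 = 0 := by
    rw [dslope_same, hd.self_of_nhds.deriv, zero_mul]
  have hw := analyticAt_dslope (analyticAt_dslope hW)
  have heq : ∀ x, W x = x ^ 2 * dslope (dslope W 0) 0 x := by
    intro x
    have h1 := sub_smul_dslope W 0 x
    have h2 := sub_smul_dslope (dslope W 0) 0 x
    simp only [sub_zero, smul_eq_mul, hW0, hW1] at h1 h2
    rw [← h1, ← h2]; ring
  refine ⟨_, hw, ?_, heq⟩
  set w := dslope (dslope W 0) 0
  -- Compare the two derivatives of W = x² w and cancel x. The limit x → 0 then yields 2 w(0) =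
  -- c(0).
  have hev : ∀ᶠ x in 𝓝[≠] (0 : ℝ), 2 * w x + x * deriv w x = c x := by
    filter_upwards [hd.filter_mono nhdsWithin_le_nhds,
      hw.eventually_analyticAt.filter_mono nhdsWithin_le_nhds, self_mem_nhdsWithin] with x h1 h2 h3
    have h4 : HasDerivAt W (((2 : ℕ) : ℝ) * x ^ (2 - 1) * w x + x ^ 2 * deriv w x) x :=
      ((hasDerivAt_pow 2 x).mul h2.differentiableAt.hasDerivAt).congr_of_eventuallyEq
        (Eventually.of_forall heq)
    have h5 := h1.unique h4
    have h6 : x ≠ 0 := h3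
    apply mul_left_cancel₀ h6
    rw [h5]; push_cast; ring
  have hl : Tendsto (fun x => 2 * w x + x * deriv w x) (𝓝[≠] (0 : ℝ)) (𝓝 (2 * w 0 + 0 * deriv w 0)) :=
    (((hw.continuousAt.const_mul 2).add
      (continuousAt_id.mul hw.deriv.continuousAt)).tendsto).mono_left nhdsWithin_le_nhds
  have hr : Tendsto c (𝓝[≠] (0 : ℝ)) (𝓝 (c 0)) := hc.tendsto.mono_left nhdsWithin_le_nhds
  have := tendsto_nhds_unique (hl.congr' hev) hr
  linarith

/-- Near `0`, `X` is an analytic function of `x`, with `X = Q g` for the restoring force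
`g = β exp (∫₀ˣ ξ/α)` and a positive analytic factor `Q`. -/
theorem exists_normal_form {α β ξ : ℝ → ℝ} (hα : AnalyticAt ℝ α 0) (hβ : AnalyticAt ℝ β 0)
    (hξ : AnalyticAt ℝ ξ 0) (hαpos : 0 < α 0)
    (hβpos : ∀ᶠ x in 𝓝 (0 : ℝ), x ≠ 0 → 0 < x * β x) (hnorm : α 0 * deriv β 0 = 1) :
    AnalyticAt ℝ (expo α ξ) 0 ∧ AnalyticAt ℝ (bigX α β ξ) 0 ∧
      (∀ᶠ x in 𝓝 (0 : ℝ), HasDerivAt (expo α ξ) (ξ x / α x) x) ∧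
      ∃ Q : ℝ → ℝ, AnalyticAt ℝ Q 0 ∧ Q 0 = 1 ∧ ∀ᶠ x in 𝓝 (0 : ℝ),
        bigX α β ξ x = Q x * (β x * Real.exp (expo α ξ x)) ∧
        HasDerivAt (bigX α β ξ) (Real.exp (expo α ξ x) / (α x * Q x)) x := by
  have hα0 : α 0 ≠ 0 := hαpos.ne'
  obtain ⟨hF, hFd⟩ := analyticAt_integral (hξ.div hα hα0)
  change AnalyticAt ℝ (expo α ξ) 0 at hF
  change ∀ᶠ x in 𝓝 (0 : ℝ), HasDerivAt (expo α ξ) (ξ x / α x) x at hFd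
  have hF2 : AnalyticAt ℝ (fun x => Real.exp (2 * expo α ξ x)) 0 :=
    analyticAt_rexp.fun_comp_of_eq (analyticAt_const.mul hF) rfl
  have hF1 : AnalyticAt ℝ (fun x => Real.exp (expo α ξ x)) 0 :=
    analyticAt_rexp.fun_comp_of_eq hF rfl
  obtain ⟨hW, hWd⟩ := analyticAt_integral ((hβ.div hα hα0).mul hF2)
  set W : ℝ → ℝ := fun x => ∫ s in (0 : ℝ)..x,
    ((β / α) * fun x => Real.exp (2 * expo α ξ x)) s with hWdef
  have hβ0 := eq_zero_of_mul_pos hβ hβpos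
  set b := dslope β 0 with hb
  have hban : AnalyticAt ℝ b 0 := analyticAt_dslope hβ
  have hb0 : b 0 = deriv β 0 := dslope_same β 0
  have hβb : ∀ x, β x = x * b x := fun x => by
    simpa [hβ0] using (sub_smul_dslope β 0 x).symm
  have hbpos : 0 < b 0 := by
    rw [hb0]; by_contra! hneg; nlinarith
  obtain ⟨w, hw, hw0, hWw⟩ := exists_eq_sq_mul (c := fun x => b x / α x * Real.exp (2 * expo α ξ x))
    hW ((hban.div hα hα0).mul hF2).continuousAt (by simp [hWdef]) (by
      filter_upwards [hWd] with x hx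
      convert hx using 1
      simp only [Pi.mul_apply, Pi.div_apply, hβb]; ring)
  have hw0' : w 0 = b 0 ^ 2 / 2 := by
    have : α 0 = 1 / b 0 := by rw [hb0]; exact eq_one_div_of_mul_eq_one_left hnorm
    rw [hw0, expo_zero, this]; simp; ring
  have hwpos : 0 < w 0 := by rw [hw0']; positivity
  set s : ℝ → ℝ := fun x => √(2 * w x) with hs
  have hsan : AnalyticAt ℝ s 0 := by
    have h2w : AnalyticAt ℝ (fun x => 2 * w x) 0 := analyticAt_const.mul hw
    have := (Real.contDiffAt_sqrt (n := ⊤) (show 2 * w 0 ≠ 0 by positivity)).comp (0 : ℝ)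
      h2w.contDiffAt
    exact this.analyticAt
  have hs0 : s 0 = b 0 := by
    simp only [hs, hw0']
    rw [show 2 * (b 0 ^ 2 / 2) = b 0 ^ 2 by ring, Real.sqrt_sq hbpos.le]
  have hXW : ∀ x, bigX α β ξ x = Real.sign x * √(2 * W x) := fun x => rfl
  -- The sign in the definition of X turns √(x²) = |x| back into x, which removes the singularity of
  -- the root at 0.
  have hXs : ∀ x, bigX α β ξ x = x * s x := by
    intro x
    rw [hXW, hWw, show 2 * (x ^ 2 * w x) = x ^ 2 * (2 * w x) by ring,
      Real.sqrt_mul (sq_nonneg x), Real.sqrt_sq_eq_abs, ← mul_assoc]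
    congr 1
    rcases lt_trichotomy x 0 with h | rfl | h
    · rw [Real.sign_of_neg h, abs_of_neg h]; ring
    · simp
    · rw [Real.sign_of_pos h, abs_of_pos h]; ring
  have hXan : AnalyticAt ℝ (bigX α β ξ) 0 :=
    (analyticAt_id.mul hsan).congr (Eventually.of_forall fun x => (hXs x).symm)
  -- This is X/g with the common factor x cancelled, hence analytic at 0.
  set Q : ℝ → ℝ := fun x => s x / (b x * Real.exp (expo α ξ x)) with hQ
  have hden : b 0 * Real.exp (expo α ξ 0) ≠ 0 := by positivity
  have hQan : AnalyticAt ℝ Q 0 := hsan.div (hban.mul hF1) hden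
  have hQ0 : Q 0 = 1 := by simp [hQ, hs0, expo_zero, hbpos.ne']
  refine ⟨hF, hXan, hFd, Q, hQan, hQ0, ?_⟩
  have hbev : ∀ᶠ x in 𝓝 (0 : ℝ), 0 < b x := hban.continuousAt.eventually (lt_mem_nhds hbpos)
  have hwev : ∀ᶠ x in 𝓝 (0 : ℝ), 0 < w x := hw.continuousAt.eventually (lt_mem_nhds hwpos)
  have hαev : ∀ᶠ x in 𝓝 (0 : ℝ), 0 < α x := hα.continuousAt.eventually (lt_mem_nhds hαpos)
  filter_upwards [hbev, hwev, hαev, hWd, hXan.eventually_analyticAt] with x hbx hwx hαx hWx hXx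
  have hsx : 0 < s x := Real.sqrt_pos.2 (by positivity)
  have hex := Real.exp_pos (expo α ξ x)
  refine ⟨?_, ?_⟩
  · rw [hXs, hβb]; simp only [hQ]; field_simp
  · rcases eq_or_ne x 0 with rfl | hx0
    · have h1 : HasDerivAt (fun x => x * s x) (1 * s 0 + 0 * deriv s 0) 0 :=
        (hasDerivAt_id (0 : ℝ)).mul hsan.differentiableAt.hasDerivAt
      have h2 := h1.congr_of_eventuallyEq (Eventually.of_forall hXs)
      refine h2.congr_deriv ?_
      rw [hQ0, expo_zero, hs0, hb0, Real.exp_zero, mul_one, one_mul, zero_mul, add_zero]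
      exact eq_one_div_of_mul_eq_one_right hnorm
    · have hsq : ∀ y, 0 < w y → bigX α β ξ y ^ 2 = 2 * W y := by
        intro y hy
        rw [hXs, hWw, mul_pow, Real.sq_sqrt (by positivity)]; ring
      have hd := hXx.differentiableAt.hasDerivAt
      have hwx' : ∀ᶠ y in 𝓝 x, bigX α β ξ y ^ 2 = 2 * W y := by
        have hsw : ∀ᶠ y in 𝓝 x, 0 < bigX α β ξ y / y := by
          refine (hXx.continuousAt.div continuousAt_id hx0).eventually (lt_mem_nhds ?_)
          simpa [hXs, hx0] using hsx
        filter_upwards [hsw] with y hy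
        refine hsq y ?_
        rw [hXs] at hy
        have hy0 : y ≠ 0 := by rintro rfl; simp at hy
        rw [mul_div_cancel_left₀ _ hy0] at hy
        have := Real.sqrt_pos.1 hy
        linarith
      -- Away from 0 the derivative of X comes from differentiating X² = 2W and cancelling X.
      have h3 := ((hWx.const_mul 2).congr_of_eventuallyEq hwx').unique (hd.pow 2)
      have hXne : bigX α β ξ x ≠ 0 := by rw [hXs]; positivity
      have h4 : deriv (bigX α β ξ) x = Real.exp (expo α ξ x) / (α x * Q x) := by
        apply mul_left_cancel₀ hXne
        have h5 : bigX α β ξ x * deriv (bigX α β ξ) x =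
            β x / α x * Real.exp (2 * expo α ξ x) := by
          simp only [Pi.mul_apply, Pi.div_apply] at h3
          push_cast at h3
          simp only [pow_one] at h3
          linarith
        rw [h5, hXs, hβb, two_mul, Real.exp_add]
        simp only [hQ]; field_simp
      rw [← h4]; exact hd

/-! ### Urabe functions and the identity (*). -/

/-- The local relations between the coefficients, `X`, and the factor `Q = X / g`. -/
structure IsNormalForm (α β ξ Q : ℝ → ℝ) : Prop where
  analyticAt_α : AnalyticAt ℝ α 0
  analyticAt_β : AnalyticAt ℝ β 0
  analyticAt_ξ : AnalyticAt ℝ ξ 0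
  α_pos : 0 < α 0
  analyticAt_expo : AnalyticAt ℝ (expo α ξ) 0
  analyticAt_bigX : AnalyticAt ℝ (bigX α β ξ) 0
  analyticAt_Q : AnalyticAt ℝ Q 0
  Q_zero : Q 0 = 1
  hasDerivAt_expo : ∀ᶠ x in 𝓝 (0 : ℝ), HasDerivAt (expo α ξ) (ξ x / α x) x
  bigX_eq : ∀ᶠ x in 𝓝 (0 : ℝ), bigX α β ξ x = Q x * (β x * Real.exp (expo α ξ x))
  hasDerivAt_bigX : ∀ᶠ x in 𝓝 (0 : ℝ),
    HasDerivAt (bigX α β ξ) (Real.exp (expo α ξ x) / (α x * Q x)) x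

/-- `Y` is an analytic local inverse of `X` at `0`. -/
structure IsLocalInverse (X Y : ℝ → ℝ) : Prop where
  analyticAt : AnalyticAt ℝ Y 0
  map_zero : Y 0 = 0
  left_inv : ∀ᶠ x in 𝓝 (0 : ℝ), Y (X x) = x
  right_inv : ∀ᶠ z in 𝓝 (0 : ℝ), X (Y z) = z

namespace IsNormalForm

variable {α β ξ Q Y h : ℝ → ℝ}

theorem eventually_α_pos (H : IsNormalForm α β ξ Q) : ∀ᶠ x in 𝓝 (0 : ℝ), 0 < α x :=
  H.analyticAt_α.continuousAt.eventually (lt_mem_nhds H.α_pos)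

theorem eventually_Q_pos (H : IsNormalForm α β ξ Q) : ∀ᶠ x in 𝓝 (0 : ℝ), 0 < Q x :=
  H.analyticAt_Q.continuousAt.eventually (lt_mem_nhds (by rw [H.Q_zero]; exact one_pos))

theorem tendsto_bigX (H : IsNormalForm α β ξ Q) : Tendsto (bigX α β ξ) (𝓝 0) (𝓝 0) := by
  simpa [bigX_zero] using H.analyticAt_bigX.continuousAt.tendsto

theorem exists_localInverse (H : IsNormalForm α β ξ Q) :
    ∃ Y, IsLocalInverse (bigX α β ξ) Y := by
  have hd := H.hasDerivAt_bigX.self_of_nhds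
  have hne : Real.exp (expo α ξ 0) / (α 0 * Q 0) ≠ 0 := by
    have := H.α_pos
    rw [H.Q_zero]; positivity
  have hs : HasStrictDerivAt (bigX α β ξ) (Real.exp (expo α ξ 0) / (α 0 * Q 0)) 0 := by
    rw [← hd.deriv]; exact H.analyticAt_bigX.hasStrictDerivAt
  have hf := hs.hasStrictFDerivAt_equiv hne
  have hl := hf.eventually_left_inverse
  have hr := hf.eventually_right_inverse
  rw [bigX_zero] at hr
  have hcd := H.analyticAt_bigX.contDiffAt (n := ⊤)
  have han := (hcd.to_localInverse hf.hasFDerivAt (by simp)).analyticAt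
  rw [bigX_zero] at han
  refine ⟨_, han, ?_, hl, hr⟩
  have := hl.self_of_nhds
  rwa [bigX_zero] at this

theorem isUrabeFunction_comp (H : IsNormalForm α β ξ Q) (hY : IsLocalInverse (bigX α β ξ) Y) :
    IsUrabeFunction α β ξ (fun z => Q (Y z) - 1) := by
  filter_upwards [hY.left_inv, H.bigX_eq, H.eventually_Q_pos] with x h1 h2 h3
  simp only [h1, add_sub_cancel]
  rw [h2, mul_div_cancel_left₀ _ h3.ne']; rfl

/-- Compare X = Q g with g = X/(1 + h) and cancel X. At x = 0 both sides are 1, thanks to h(0) = 0.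
-/
theorem one_add_eq_of_isUrabeFunction (H : IsNormalForm α β ξ Q)
    (hY : IsLocalInverse (bigX α β ξ) Y) (h0 : h 0 = 0) (hU : IsUrabeFunction α β ξ h) :
    ∀ᶠ x in 𝓝 (0 : ℝ), 1 + h (bigX α β ξ x) = Q x := by
  filter_upwards [hY.left_inv, H.bigX_eq, hU] with x h1 h2 h3
  rcases eq_or_ne (bigX α β ξ x) 0 with hX | hX
  · have : x = 0 := by rw [← h1, hX, hY.map_zero]
    rw [this, bigX_zero, h0, H.Q_zero, add_zero]
  · change β x * Real.exp (expo α ξ x) = _ at h3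
    rw [h3] at h2
    -- If 1 + h(X) vanished, the convention X/0 = 0 would force X = 0.
    have hne : 1 + h (bigX α β ξ x) ≠ 0 := by
      intro hz; rw [hz, div_zero, mul_zero] at h2; exact hX h2
    rw [← mul_div_assoc, eq_div_iff hne, mul_comm (Q x)] at h2
    exact mul_left_cancel₀ hX h2

theorem eq_of_isUrabeFunction (H : IsNormalForm α β ξ Q)
    (hY : IsLocalInverse (bigX α β ξ) Y) (h0 : h 0 = 0) (hU : IsUrabeFunction α β ξ h) :
    ∀ᶠ z in 𝓝 (0 : ℝ), h z = Q (Y z) - 1 := by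
  have ht : Tendsto Y (𝓝 0) (𝓝 0) := by
    simpa [hY.map_zero] using hY.analyticAt.continuousAt.tendsto
  filter_upwards [hY.right_inv, ht.eventually (H.one_add_eq_of_isUrabeFunction hY h0 hU)]
    with z h1 h2
  rw [h1] at h2; linarith

theorem eventually_hasDerivAt_comp (H : IsNormalForm α β ξ Q) (hh : ContDiffAt ℝ 1 h 0) :
    ∀ᶠ x in 𝓝 (0 : ℝ), HasDerivAt h (deriv h (bigX α β ξ x)) (bigX α β ξ x) := by
  have h1 : ∀ᶠ z in 𝓝 (0 : ℝ), HasDerivAt h (deriv h z) z := by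
    filter_upwards [hh.eventually (by simp)] with z hz
    exact (hz.differentiableAt (by simp)).hasDerivAt
  exact H.tendsto_bigX.eventually h1

theorem eventually_one_add_pos (H : IsNormalForm α β ξ Q) (hh : ContDiffAt ℝ 1 h 0)
    (h0 : h 0 = 0) : ∀ᶠ x in 𝓝 (0 : ℝ), 0 < 1 + h (bigX α β ξ x) := by
  have h1 : ∀ᶠ z in 𝓝 (0 : ℝ), 0 < 1 + h z :=
    (continuousAt_const.add hh.continuousAt).eventually (lt_mem_nhds (by simp [h0]))
  exact H.tendsto_bigX.eventually h1

theorem eventually_hasDerivAt_force (H : IsNormalForm α β ξ Q) :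
    ∀ᶠ x in 𝓝 (0 : ℝ), HasDerivAt (fun x => β x * Real.exp (expo α ξ x))
      ((α x * deriv β x + ξ x * β x) * (Real.exp (expo α ξ x) / α x)) x := by
  filter_upwards [H.eventually_α_pos, H.hasDerivAt_expo, H.analyticAt_β.eventually_analyticAt]
    with x h1 h2 h3
  refine (h3.differentiableAt.hasDerivAt.fun_mul h2.exp).congr_deriv ?_
  field_simp

theorem eventually_hasDerivAt_quotient (H : IsNormalForm α β ξ Q) (hh : ContDiffAt ℝ 1 h 0)
    (h0 : h 0 = 0) :
    ∀ᶠ x in 𝓝 (0 : ℝ), HasDerivAt (fun x => bigX α β ξ x / (1 + h (bigX α β ξ x)))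
      (Real.exp (expo α ξ x) / (α x * Q x) *
        ((1 + h (bigX α β ξ x) - deriv h (bigX α β ξ x) * bigX α β ξ x) /
          (1 + h (bigX α β ξ x)) ^ 2)) x := by
  filter_upwards [H.hasDerivAt_bigX, H.eventually_hasDerivAt_comp hh,
    H.eventually_one_add_pos hh h0] with x h1 h2 h3
  refine (h1.fun_div ((h2.comp x h1).const_add 1) h3.ne').congr_deriv ?_
  simp only [Function.comp_apply]
  ring

/-- This is the derivative of g = X/(1 + h(X)), divided by e^F/α. The quotient rule gives two of the
three powers of 1 + h; the third is the Q in X' = e^F/(α Q). -/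
theorem urabeIdentity_of_isUrabeFunction (H : IsNormalForm α β ξ Q)
    (hY : IsLocalInverse (bigX α β ξ) Y) (hh : ContDiffAt ℝ 1 h 0) (h0 : h 0 = 0)
    (hU : IsUrabeFunction α β ξ h) : UrabeIdentity α β ξ h := by
  filter_upwards [H.eventually_hasDerivAt_force, H.eventually_hasDerivAt_quotient hh h0,
    H.one_add_eq_of_isUrabeFunction hY h0 hU, eventually_eventually_nhds.2 hU,
    H.eventually_α_pos, H.eventually_Q_pos] with x h1 h2 h3 h4 h5 h6
  have h7 := (h2.congr_of_eventuallyEq h4).unique h1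
  rw [h3] at h7 ⊢
  have hE := Real.exp_pos (expo α ξ x)
  have hne : Real.exp (expo α ξ x) / α x ≠ 0 := by positivity
  apply mul_right_cancel₀ hne
  rw [← h7]
  field_simp

/-- Here Q = 1 + h is not yet known. In the derivatives of g² and (X/(1 + h))² the factor 1/Q occurs
alike, once from g = X/Q and once from X', so (*) makes them equal. The sign left open by the
squares is fixed by Q > 0 and 1 + h > 0. -/
theorem isUrabeFunction_of_urabeIdentity (H : IsNormalForm α β ξ Q)
    (hh : ContDiffAt ℝ 1 h 0) (h0 : h 0 = 0)
    (hI : UrabeIdentity α β ξ h) : IsUrabeFunction α β ξ h := by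
  set D : ℝ → ℝ := fun x => (β x * Real.exp (expo α ξ x)) ^ 2 -
    (bigX α β ξ x / (1 + h (bigX α β ξ x))) ^ 2 with hD
  have hder : ∀ᶠ x in 𝓝 (0 : ℝ), HasDerivAt D 0 x := by
    filter_upwards [H.eventually_hasDerivAt_force, H.eventually_hasDerivAt_quotient hh h0, hI,
      H.eventually_α_pos, H.eventually_Q_pos, H.bigX_eq, H.eventually_one_add_pos hh h0]
      with x h1 h2 h3 h4 h5 h6 h7
    refine ((h1.fun_pow 2).fun_sub (h2.fun_pow 2)).congr_deriv ?_
    rw [h3]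
    have hb : β x * Real.exp (expo α ξ x) = bigX α β ξ x / Q x := by
      rw [h6, mul_div_cancel_left₀ _ h5.ne']
    rw [hb]
    push_cast
    field_simp
    ring
  obtain ⟨ε, hε, hball⟩ := Metric.eventually_nhds_iff_ball.1 hder
  have hconst : ∀ x ∈ Metric.ball (0 : ℝ) ε, D x = D 0 := fun x hx =>
    Metric.isOpen_ball.is_const_of_deriv_eq_zero (convex_ball (0 : ℝ) ε).isPreconnected
      (fun y hy => (hball y hy).differentiableAt.differentiableWithinAt)
      (fun y hy => (hball y hy).deriv) hx (Metric.mem_ball_self hε)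
  have hD0 : D 0 = 0 := by
    have := H.bigX_eq.self_of_nhds
    rw [bigX_zero, H.Q_zero, one_mul] at this
    simp [hD, ← this, bigX_zero]
  filter_upwards [Metric.ball_mem_nhds (0 : ℝ) hε, H.bigX_eq, H.eventually_Q_pos,
    H.eventually_one_add_pos hh h0] with x hx h1 h2 h3
  have h4 := hconst x hx
  rw [hD0] at h4
  have hb : β x * Real.exp (expo α ξ x) = bigX α β ξ x / Q x := by
    rw [h1, mul_div_cancel_left₀ _ h2.ne']
  change β x * Real.exp (expo α ξ x) = _
  simp only [hD, hb] at h4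
  rw [hb]
  rcases sq_eq_sq_iff_eq_or_eq_neg.1 (sub_eq_zero.1 h4) with h5 | h5
  · exact h5
  · rcases eq_or_ne (bigX α β ξ x) 0 with hX | hX
    · simp [hX]
    · rw [div_eq_iff h2.ne', neg_mul, div_mul_eq_mul_div, ← neg_div, eq_div_iff h3.ne'] at h5
      have : bigX α β ξ x * (1 + h (bigX α β ξ x) + Q x) = 0 := by linarith
      rcases mul_eq_zero.1 this with h6 | h6
      · exact absurd h6 hX
      · linarith

theorem eventually_eq_one_iff (H : IsNormalForm α β ξ Q) (hY : IsLocalInverse (bigX α β ξ) Y)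
    (h0 : h 0 = 0) (hU : IsUrabeFunction α β ξ h) (hI : UrabeIdentity α β ξ h) :
    (∀ᶠ x in 𝓝 (0 : ℝ), α x * deriv β x + ξ x * β x = 1) ↔ ∀ᶠ X in 𝓝 (0 : ℝ), h X = 0 := by
  constructor
  · intro h1
    -- When the left side of (*) is 1, the zero function also solves (*), and uniqueness of the
    -- Urabe function gives h = 0.
    have hI0 : UrabeIdentity α β ξ (fun _ => 0) := by
      filter_upwards [h1] with x hx
      simp [hx]
    have hU0 := H.isUrabeFunction_of_urabeIdentity contDiffAt_const rfl hI0
    filter_upwards [H.eq_of_isUrabeFunction hY h0 hU,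
      H.eq_of_isUrabeFunction (h := fun _ => 0) hY rfl hU0] with z h2 h3
    rw [h2, ← h3]
  · intro h1
    filter_upwards [hI, H.tendsto_bigX.eventually (eventually_eventually_nhds.2 h1)] with x h2 h3
    have h4 : h =ᶠ[𝓝 (bigX α β ξ x)] fun _ => 0 := h3
    rw [h2, h4.deriv_eq, h4.eq_of_nhds]
    simp

end IsNormalForm

/-! ### Angular motion, averages over circles and uniqueness of orbits. -/

/-- Solves Θ' = 1/f(Θ) by inverting the elapsed time τ(θ) = ∫₀^θ f. Periodicity of f makes τ gain
one fixed amount per turn. -/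
theorem exists_angle {f : ℝ → ℝ} (hf : Continuous f) (hpos : ∀ θ, 0 < f θ)
    (hper : Function.Periodic f (2 * Real.pi)) (θ₀ : ℝ) :
    ∃ Θ : ℝ → ℝ, Θ 0 = θ₀ ∧ (∀ t, HasDerivAt Θ (f (Θ t))⁻¹ t) ∧ StrictMono Θ ∧
      ∀ t, Θ (t + ∫ θ in (0 : ℝ)..2 * Real.pi, f θ) = Θ t + 2 * Real.pi := by
  set τ : ℝ → ℝ := fun x => ∫ θ in (0 : ℝ)..x, f θ with hτ
  have hd : ∀ x, HasDerivAt τ (f x) x := fun x =>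
    intervalIntegral.integral_hasDerivAt_right (hf.intervalIntegrable _ _)
      (hf.stronglyMeasurableAtFilter _ _) hf.continuousAt
  have hmono : StrictMono τ := strictMono_of_deriv_pos fun x => by rw [(hd x).deriv]; exact hpos x
  have hcont : Continuous τ := continuous_iff_continuousAt.2 fun x => (hd x).continuousAt
  have hint : ∀ a b, IntervalIntegrable f MeasureTheory.volume a b :=
    fun a b => hf.intervalIntegrable a b
  have htop : Tendsto τ atTop atTop :=
    hper.tendsto_atTop_intervalIntegral_of_pos' (hint _ _) hpos Real.two_pi_pos
  have hbot : Tendsto τ atBot atBot :=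
    hper.tendsto_atBot_intervalIntegral_of_pos' (hint _ _) hpos Real.two_pi_pos
  have hsurj : Function.Surjective τ := hcont.surjective htop hbot
  let e : ℝ ≃o ℝ := hmono.orderIsoOfSurjective τ hsurj
  have he : ∀ x, e x = τ x := fun x => rfl
  have hesymm : ∀ t, τ (e.symm t) = t := fun t => by rw [← he, e.apply_symm_apply]
  have hed : ∀ t, HasDerivAt e.symm (f (e.symm t))⁻¹ t := fun t =>
    HasDerivAt.of_local_left_inverse e.symm.continuous.continuousAt (hd _) (hpos _).ne'
      (Eventually.of_forall hesymm)
  refine ⟨fun t => e.symm (t + τ θ₀), ?_, fun t => ?_, fun a b hab => ?_, fun t => ?_⟩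
  · change e.symm (0 + τ θ₀) = θ₀
    rw [zero_add, ← he, e.symm_apply_apply]
  · exact (hed (t + τ θ₀)).comp_add_const t (τ θ₀)
  · exact e.symm.strictMono (by simpa using hab)
  · change e.symm (t + τ (2 * Real.pi) + τ θ₀) = e.symm (t + τ θ₀) + 2 * Real.pi
    rw [e.symm_apply_eq, he]
    have h1 : τ (e.symm (t + τ θ₀) + 2 * Real.pi) =
        τ (e.symm (t + τ θ₀)) + τ (2 * Real.pi) := by
      simp only [hτ]
      rw [← intervalIntegral.integral_add_adjacent_intervals (hint 0 (e.symm (t + τ θ₀)))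
        (hint _ _), hper.intervalIntegral_add_eq (e.symm (t + τ θ₀)) 0, zero_add]
    rw [h1, hesymm]; ring

theorem integral_comp_neg_mul_cos (f : ℝ → ℝ) (r : ℝ) :
    ∫ θ in (0 : ℝ)..2 * Real.pi, f (-(r * Real.cos θ)) =
      ∫ θ in (0 : ℝ)..2 * Real.pi, f (r * Real.cos θ) := by
  have hper : Function.Periodic (fun θ => f (r * Real.cos θ)) (2 * Real.pi) := fun θ => by
    simp only [Real.cos_add_two_pi]
  have h1 := intervalIntegral.integral_comp_add_right (a := 0) (b := 2 * Real.pi)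
    (fun θ => f (r * Real.cos θ)) Real.pi
  simp only [Real.cos_add_pi, mul_neg] at h1
  rw [h1, zero_add, add_comm (2 * Real.pi), hper.intervalIntegral_add_eq Real.pi 0, zero_add]

theorem exists_Ioo_pos_or_neg {e : ℝ → ℝ} {ε : ℝ} (hc : ContinuousOn e (Set.Ioo 0 ε))
    (hne : ∀ z ∈ Set.Ioo 0 ε, e z ≠ 0) :
    (∀ z ∈ Set.Ioo 0 ε, 0 < e z) ∨ ∀ z ∈ Set.Ioo 0 ε, e z < 0 := by
  by_contra! hcon
  obtain ⟨⟨a, ha, ha'⟩, b, hb, hb'⟩ := hcon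
  obtain ⟨z, hz, hz'⟩ := isPreconnected_Ioo.intermediate_value ha hb hc ⟨ha', hb'⟩
  exact hne z hz hz'

/-- Evenness and continuity at 0 make the integrand nonnegative, and at θ = 0 it is e(r) > 0. -/
theorem integral_comp_mul_cos_pos {e : ℝ → ℝ} {ε r : ℝ} (hr : 0 < r) (hrε : r < ε)
    (hc : ContinuousOn e (Metric.ball 0 ε)) (heven : ∀ z ∈ Metric.ball (0 : ℝ) ε, e (-z) = e z)
    (hpos : ∀ z ∈ Set.Ioo 0 ε, 0 < e z) :
    0 < ∫ θ in (0 : ℝ)..2 * Real.pi, e (r * Real.cos θ) := by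
  have hε : 0 < ε := hr.trans hrε
  have hmem : ∀ θ, r * Real.cos θ ∈ Metric.ball (0 : ℝ) ε := fun θ => by
    rw [mem_ball_zero_iff, Real.norm_eq_abs, abs_mul, abs_of_pos hr]
    nlinarith [Real.abs_cos_le_one θ]
  have he0 : 0 ≤ e 0 := by
    have ht : Tendsto e (𝓝[>] 0) (𝓝 (e 0)) :=
      ((hc.continuousAt (Metric.ball_mem_nhds _ hε)).tendsto).mono_left nhdsWithin_le_nhds
    refine ge_of_tendsto ht ?_
    filter_upwards [Ioo_mem_nhdsGT hε] with z hz using (hpos z hz).le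
  have hnn : ∀ z ∈ Metric.ball (0 : ℝ) ε, 0 ≤ e z := by
    intro z hz
    have hz' := abs_lt.1 (by simpa using hz : |z| < ε)
    rcases lt_trichotomy z 0 with h | rfl | h
    · rw [← heven z hz]; exact (hpos _ ⟨by linarith, by linarith⟩).le
    · exact he0
    · exact (hpos z ⟨h, hz'.2⟩).le
  refine intervalIntegral.integral_pos Real.two_pi_pos ?_ (fun θ _ => hnn _ (hmem θ))
    ⟨0, ⟨le_rfl, Real.two_pi_pos.le⟩, ?_⟩
  · exact hc.comp (by fun_prop) fun θ _ => hmem θ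
  · rw [Real.cos_zero, mul_one]; exact hpos r ⟨hr, hrε⟩

/-- An even analytic function is determined by its averages over small circles. -/
theorem eventually_eq_zero_of_integral_comp_cos {e : ℝ → ℝ} (he : AnalyticAt ℝ e 0)
    (heven : ∀ z, e (-z) = e z)
    (hint : ∀ᶠ r in 𝓝[>] (0 : ℝ), ∫ θ in (0 : ℝ)..2 * Real.pi, e (r * Real.cos θ) = 0) :
    ∀ᶠ z in 𝓝 (0 : ℝ), e z = 0 := by
  -- Otherwise e has no zeros in a punctured neighbourhood, so it has constant sign on some (0, ε)
  -- and its averages cannot vanish.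
  refine he.eventually_eq_zero_or_eventually_ne_zero.resolve_right fun hne => ?_
  obtain ⟨ε, hε, hball⟩ := Metric.eventually_nhds_iff_ball.1
    ((eventually_nhdsWithin_iff.1 hne).and he.eventually_analyticAt)
  have hc : ContinuousOn e (Metric.ball 0 ε) := fun z hz =>
    (hball z hz).2.continuousAt.continuousWithinAt
  have hsub : Set.Ioo 0 ε ⊆ Metric.ball (0 : ℝ) ε := fun z hz => by
    rw [mem_ball_zero_iff, Real.norm_eq_abs, abs_of_pos hz.1]; exact hz.2
  obtain ⟨r, hr0, hr⟩ := (hint.and (Ioo_mem_nhdsGT hε)).exists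
  rcases exists_Ioo_pos_or_neg (hc.mono hsub)
    (fun z hz => (hball z (hsub hz)).1 hz.1.ne') with h | h
  · exact (integral_comp_mul_cos_pos hr.1 hr.2 hc (fun z _ => heven z) h).ne' hr0
  · have := integral_comp_mul_cos_pos (e := fun z => -e z) hr.1 hr.2 hc.neg
      (fun z _ => by rw [heven z]) (fun z hz => neg_pos.2 (h z hz))
    rw [intervalIntegral.integral_neg, hr0, neg_zero] at this
    exact lt_irrefl _ this

/-- The coincidence set is closed by continuity and open by local Lipschitz uniqueness. Smoothness
is needed only along one of the curves. -/
theorem integralCurve_eq_of_contDiffAt {V : ℝ × ℝ → ℝ × ℝ} {γ₁ γ₂ : ℝ → ℝ × ℝ}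
    (h₁ : IsIntegralCurve γ₁ (fun _ => V)) (h₂ : IsIntegralCurve γ₂ (fun _ => V))
    (hV : ∀ t, ContDiffAt ℝ 1 V (γ₂ t)) (h0 : γ₁ 0 = γ₂ 0) : γ₁ = γ₂ := by
  have hc₁ : Continuous γ₁ := continuous_iff_continuousAt.2 fun t => (h₁ t).continuousAt
  have hc₂ : Continuous γ₂ := continuous_iff_continuousAt.2 fun t => (h₂ t).continuousAt
  have hclopen : IsClopen {t | γ₁ t = γ₂ t} := by
    refine ⟨isClosed_eq hc₁ hc₂, isOpen_iff_mem_nhds.2 fun t ht => ?_⟩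
    have ht' : γ₁ t = γ₂ t := ht
    obtain ⟨K, s, hs, hlip⟩ := (hV t).exists_lipschitzOnWith
    have hs₁ : ∀ᶠ t' in 𝓝 t, γ₁ t' ∈ s := hc₁.continuousAt (by rw [ht']; exact hs)
    have hs₂ : ∀ᶠ t' in 𝓝 t, γ₂ t' ∈ s := hc₂.continuousAt hs
    exact ODE_solution_unique_of_eventually (v := fun _ => V) (s := fun _ => s)
      (Eventually.of_forall fun _ => hlip) (hs₁.mono fun t' h => ⟨h₁ t', h⟩)
      (hs₂.mono fun t' h => ⟨h₂ t', h⟩) ht'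
  have huniv := hclopen.eq_univ ⟨0, h0⟩
  funext t
  exact (Set.eq_univ_iff_forall.1 huniv t : γ₁ t = γ₂ t)

/-! ### The polar chart and its orbits. -/

/-- The point of the phase plane with polar coordinates `r, θ` in the linearizing chart. -/
noncomputable def polarPoint (α ξ Y : ℝ → ℝ) (r θ : ℝ) : ℝ × ℝ :=
  (Y (r * Real.cos θ),
    Real.exp (-expo α ξ (Y (r * Real.cos θ))) * (r * Real.sin θ))

/-- The relations at a point `z` of the `X`-axis on which the analysis of the flow rests. -/
structure IsRegularPoint (α β ξ Q Y : ℝ → ℝ) (z : ℝ) : Prop where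
  hasDerivAt_Y : HasDerivAt Y (α (Y z) * Q (Y z) / Real.exp (expo α ξ (Y z))) z
  hasDerivAt_expo : HasDerivAt (expo α ξ) (ξ (Y z) / α (Y z)) (Y z)
  α_pos : 0 < α (Y z)
  Q_pos : 0 < Q (Y z)
  eq_mul : z = Q (Y z) * (β (Y z) * Real.exp (expo α ξ (Y z)))
  right_inv : bigX α β ξ (Y z) = z
  continuousAt_Q : ContinuousAt Q (Y z)
  analyticAt_α : AnalyticAt ℝ α (Y z)
  analyticAt_β : AnalyticAt ℝ β (Y z)
  analyticAt_ξ : AnalyticAt ℝ ξ (Y z)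

variable {α β ξ Q Y h : ℝ → ℝ}

theorem IsNormalForm.eventually_isRegularPoint (H : IsNormalForm α β ξ Q)
    (hY : IsLocalInverse (bigX α β ξ) Y) : ∀ᶠ z in 𝓝 (0 : ℝ), IsRegularPoint α β ξ Q Y z := by
  have ht : Tendsto Y (𝓝 0) (𝓝 0) := by
    simpa [hY.map_zero] using hY.analyticAt.continuousAt.tendsto
  filter_upwards [hY.analyticAt.eventually_analyticAt, eventually_eventually_nhds.2 hY.right_inv,
    ht.eventually H.hasDerivAt_bigX, ht.eventually H.hasDerivAt_expo,
    ht.eventually H.bigX_eq, ht.eventually H.eventually_α_pos, ht.eventually H.eventually_Q_pos,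
    ht.eventually H.analyticAt_Q.eventually_analyticAt,
    ht.eventually H.analyticAt_α.eventually_analyticAt,
    ht.eventually H.analyticAt_β.eventually_analyticAt,
    ht.eventually H.analyticAt_ξ.eventually_analyticAt] with z h1 h2 h3 h4 h5 h6 h7 h8 h9 h10 h11
  have hr := h2.self_of_nhds
  refine ⟨?_, h4, h6, h7, by rw [← h5, hr], hr, h8.continuousAt, h9, h10, h11⟩
  have hne : Real.exp (expo α ξ (Y z)) / (α (Y z) * Q (Y z)) ≠ 0 := by positivity
  refine (HasDerivAt.of_local_left_inverse h1.continuousAt h3 hne h2).congr_deriv ?_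
  rw [inv_div]

theorem contDiffAt_field {p : ℝ × ℝ} (hα : AnalyticAt ℝ α p.1) (hβ : AnalyticAt ℝ β p.1)
    (hξ : AnalyticAt ℝ ξ p.1) : ContDiffAt ℝ 1 (field α β ξ) p := by
  have ha : ContDiffAt ℝ 1 (fun p : ℝ × ℝ => α p.1) p := hα.contDiffAt.comp p contDiffAt_fst
  have hb : ContDiffAt ℝ 1 (fun p : ℝ × ℝ => β p.1) p := hβ.contDiffAt.comp p contDiffAt_fst
  have hx : ContDiffAt ℝ 1 (fun p : ℝ × ℝ => ξ p.1) p := hξ.contDiffAt.comp p contDiffAt_fst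
  exact (ha.neg.mul contDiffAt_snd).prodMk (hb.add (hx.mul (contDiffAt_snd.pow 2)))

theorem abs_mul_cos_lt {r ρ : ℝ} (hr : 0 < r) (hrρ : r < ρ) (θ : ℝ) :
    |r * Real.cos θ| < ρ := by
  rw [abs_mul, abs_of_pos hr]
  nlinarith [Real.abs_cos_le_one θ]

/-- In v = e^F y the ξ y² term cancels against the derivative of e^F, leaving a rotation with
angular speed 1/Q. -/
theorem hasDerivAt_polarPoint {r t : ℝ} {Θ : ℝ → ℝ}
    (hreg : IsRegularPoint α β ξ Q Y (r * Real.cos (Θ t)))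
    (hΘ : HasDerivAt Θ (Q (Y (r * Real.cos (Θ t))))⁻¹ t) :
    HasDerivAt (fun t => polarPoint α ξ Y r (Θ t)) (field α β ξ (polarPoint α ξ Y r (Θ t))) t := by
  have hz : HasDerivAt (fun t => r * Real.cos (Θ t)) _ t := hΘ.cos.const_mul r
  have hv : HasDerivAt (fun t => r * Real.sin (Θ t)) _ t := hΘ.sin.const_mul r
  have hx := hreg.hasDerivAt_Y.comp t hz
  have hF := (hreg.hasDerivAt_expo.comp t hx).fun_neg.exp
  have hy := hF.fun_mul hv
  have hQ := hreg.Q_pos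
  have hα := hreg.α_pos
  have hE := Real.exp_pos (expo α ξ (Y (r * Real.cos (Θ t))))
  refine (hx.prodMk hy).congr_deriv ?_
  have hβ : β (Y (r * Real.cos (Θ t))) = r * Real.cos (Θ t) /
      (Q (Y (r * Real.cos (Θ t))) * Real.exp (expo α ξ (Y (r * Real.cos (Θ t))))) := by
    rw [eq_div_iff (by positivity)]; linarith [hreg.eq_mul]
  simp only [field, polarPoint, Function.comp_apply]
  rw [hβ, Real.exp_neg]
  ext
  · simp only; field_simp
  · simp only; field_simp; ring

theorem polarPoint_inj {r θ₁ θ₂ : ℝ} (hr : 0 < r)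
    (h₁ : IsRegularPoint α β ξ Q Y (r * Real.cos θ₁))
    (h₂ : IsRegularPoint α β ξ Q Y (r * Real.cos θ₂))
    (heq : polarPoint α ξ Y r θ₁ = polarPoint α ξ Y r θ₂) :
    ∃ n : ℤ, θ₁ - θ₂ = 2 * Real.pi * n := by
  simp only [polarPoint, Prod.mk.injEq] at heq
  obtain ⟨hY, hv⟩ := heq
  have hcos : Real.cos θ₁ = Real.cos θ₂ := by
    have : r * Real.cos θ₁ = r * Real.cos θ₂ := by rw [← h₁.right_inv, hY, h₂.right_inv]
    exact mul_left_cancel₀ hr.ne' this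
  have hsin : Real.sin θ₁ = Real.sin θ₂ := by
    rw [hY] at hv
    exact mul_left_cancel₀ hr.ne' (mul_left_cancel₀ (Real.exp_pos _).ne' hv)
  exact Real.Angle.angle_eq_iff_two_pi_dvd_sub.1 (Real.Angle.cos_sin_inj hcos hsin)

/-- The orbits on small circles of the chart, with their minimal period. -/
theorem exists_orbit {ρ r : ℝ} (hreg : ∀ z, |z| < ρ → IsRegularPoint α β ξ Q Y z)
    (hr : 0 < r) (hrρ : r < ρ) (θ₀ : ℝ) :
    ∃ γ : ℝ → ℝ × ℝ, γ 0 = polarPoint α ξ Y r θ₀ ∧ (∀ t, ∃ θ, γ t = polarPoint α ξ Y r θ) ∧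
      IsIntegralCurve γ (fun _ => field α β ξ) ∧
      IsLeast {S : ℝ | 0 < S ∧ Function.Periodic γ S}
        (∫ θ in (0 : ℝ)..2 * Real.pi, Q (Y (r * Real.cos θ))) := by
  have hR : ∀ θ, IsRegularPoint α β ξ Q Y (r * Real.cos θ) := fun θ =>
    hreg _ (abs_mul_cos_lt hr hrρ θ)
  set f : ℝ → ℝ := fun θ => Q (Y (r * Real.cos θ)) with hf
  have hfc : Continuous f := continuous_iff_continuousAt.2 fun θ => by
    have h1 : ContinuousAt (fun z => Q (Y z)) (r * Real.cos θ) :=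
      (hR θ).continuousAt_Q.comp (hR θ).hasDerivAt_Y.continuousAt
    exact h1.comp (f := fun θ => r * Real.cos θ) (by fun_prop)
  have hfpos : ∀ θ, 0 < f θ := fun θ => (hR θ).Q_pos
  have hper : Function.Periodic f (2 * Real.pi) := fun θ => by
    simp only [hf, Real.cos_add_two_pi]
  obtain ⟨Θ, hΘ0, hΘd, hΘm, hΘp⟩ := exists_angle hfc hfpos hper θ₀
  set T := ∫ θ in (0 : ℝ)..2 * Real.pi, f θ with hT
  have hTpos : 0 < T := intervalIntegral.intervalIntegral_pos_of_pos
    (hfc.intervalIntegrable _ _) hfpos Real.two_pi_pos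
  refine ⟨fun t => polarPoint α ξ Y r (Θ t), by simp only [hΘ0], fun t => ⟨_, rfl⟩,
    fun t => hasDerivAt_polarPoint (hR _) (hΘd t), ⟨hTpos, fun t => ?_⟩, fun S hS => ?_⟩
  · simp only [polarPoint, hΘp t, Real.cos_add_two_pi, Real.sin_add_two_pi]
  · obtain ⟨hS0, hSp⟩ := hS
    have h1 := hSp 0
    -- A period S advances the angle by a positive multiple of 2π, hence by at least the advance
    -- over T. Monotonicity of Θ then gives T ≤ S.
    obtain ⟨n, hn⟩ := polarPoint_inj hr (hR _) (hR _) h1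
    have h2 : Θ 0 < Θ (0 + S) := hΘm (by simpa using hS0)
    have hn1 : 1 ≤ n := by
      by_contra! hlt
      have h3 : (n : ℝ) ≤ 0 := by exact_mod_cast (by omega : n ≤ 0)
      nlinarith [Real.two_pi_pos]
    have h4 : (1 : ℝ) ≤ n := by exact_mod_cast hn1
    have h5 : Θ (0 + T) ≤ Θ (0 + S) := by
      rw [hΘp]; nlinarith [Real.two_pi_pos]
    simpa using hΘm.le_iff_le.1 h5

/-! ### Isochronicity and oddness of Q ∘ Y - 1. -/

theorem exists_isNormalForm (hα : AnalyticAt ℝ α 0) (hβ : AnalyticAt ℝ β 0)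
    (hξ : AnalyticAt ℝ ξ 0) (hαpos : 0 < α 0)
    (hβpos : ∀ᶠ x in 𝓝 (0 : ℝ), x ≠ 0 → 0 < x * β x) (hnorm : α 0 * deriv β 0 = 1) :
    ∃ Q, IsNormalForm α β ξ Q := by
  obtain ⟨hF, hX, hFd, Q, hQ, hQ0, hev⟩ := exists_normal_form hα hβ hξ hαpos hβpos hnorm
  exact ⟨Q, hα, hβ, hξ, hαpos, hF, hX, hQ, hQ0, hFd, hev.mono fun _ h => h.1,
    hev.mono fun _ h => h.2⟩

theorem IsOddC1.map_zero (hh : IsOddC1 h) : h 0 = 0 := by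
  have := hh.2.self_of_nhds
  rw [neg_zero] at this
  linarith

namespace IsNormalForm

theorem tendsto_localInverse (hY : IsLocalInverse (bigX α β ξ) Y) :
    Tendsto Y (𝓝 0) (𝓝 0) := by
  simpa [hY.map_zero] using hY.analyticAt.continuousAt.tendsto

/-- Points near the origin are covered by the polar chart. -/
theorem eventually_exists_polarPoint (H : IsNormalForm α β ξ Q)
    (hY : IsLocalInverse (bigX α β ξ) Y) {ρ : ℝ} (hρ : 0 < ρ) :
    ∀ᶠ q in 𝓝 ((0, 0) : ℝ × ℝ), ∃ r θ, 0 ≤ r ∧ r < ρ ∧ q = polarPoint α ξ Y r θ := by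
  have h1 : ∀ᶠ q in 𝓝 ((0, 0) : ℝ × ℝ), Y (bigX α β ξ q.1) = q.1 :=
    (continuous_fst.tendsto ((0, 0) : ℝ × ℝ)).eventually hY.left_inv
  have hX : ContinuousAt (fun q : ℝ × ℝ => bigX α β ξ q.1) (0, 0) :=
    ContinuousAt.comp (f := Prod.fst) (x := ((0, 0) : ℝ × ℝ))
      H.analyticAt_bigX.continuousAt continuousAt_fst
  have hF : ContinuousAt (fun q : ℝ × ℝ => expo α ξ q.1) (0, 0) :=
    ContinuousAt.comp (f := Prod.fst) (x := ((0, 0) : ℝ × ℝ))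
      H.analyticAt_expo.continuousAt continuousAt_fst
  -- The complex number X + i e^F y has the required polar coordinates as modulus and argument.
  set w : ℝ × ℝ → ℂ := fun q =>
    (bigX α β ξ q.1 : ℂ) + ((Real.exp (expo α ξ q.1) * q.2 : ℝ) : ℂ) * Complex.I with hw
  have hwc : ContinuousAt w (0, 0) :=
    (Complex.continuous_ofReal.continuousAt.comp hX).add
      ((Complex.continuous_ofReal.continuousAt.comp (hF.rexp.mul continuousAt_snd)).mul
        continuousAt_const)
  have hw0 : w (0, 0) = 0 := by simp [hw, bigX_zero]
  have h2 : ∀ᶠ q in 𝓝 ((0, 0) : ℝ × ℝ), ‖w q‖ < ρ :=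
    hwc.norm.eventually (gt_mem_nhds (by simpa [hw0] using hρ))
  filter_upwards [h1, h2] with q hq1 hq2
  refine ⟨‖w q‖, Complex.arg (w q), norm_nonneg _, hq2, ?_⟩
  have hre : (w q).re = bigX α β ξ q.1 := by simp [hw]
  have him : (w q).im = Real.exp (expo α ξ q.1) * q.2 := by
    simp only [hw, Complex.add_im, Complex.ofReal_im, Complex.im_ofReal_mul, Complex.I_im, zero_add,
      mul_one]
  simp only [polarPoint, Complex.norm_mul_cos_arg, Complex.norm_mul_sin_arg, hre, him, hq1]
  rw [← mul_assoc, ← Real.exp_add, neg_add_cancel, Real.exp_zero, one_mul]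

/-- The periods of z ↦ Q(Y(z)) and z ↦ Q(Y(-z)) as integrands agree and add up to ∫₀^{2π} 2 dθ, so
each is 2π. -/
theorem isIsochronousCenter (H : IsNormalForm α β ξ Q)
    (hY : IsLocalInverse (bigX α β ξ) Y) (hβ0 : β 0 = 0) {N₀ : Set ℝ} (hN₀ : N₀ ∈ 𝓝 (0 : ℝ))
    (hodd : ∀ᶠ z in 𝓝 (0 : ℝ), Q (Y (-z)) + Q (Y z) = 2) :
    IsIsochronousCenter (field α β ξ) (N₀ ×ˢ Set.univ) (0, 0) := by
  obtain ⟨ρ, hρ, hball⟩ := Metric.eventually_nhds_iff_ball.1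
    (((H.eventually_isRegularPoint hY).and hodd).and
      ((tendsto_localInverse hY).eventually hN₀))
  have hmem : ∀ {z : ℝ}, |z| < ρ → z ∈ Metric.ball (0 : ℝ) ρ := fun hz => by simpa using hz
  have hreg : ∀ z, |z| < ρ → IsRegularPoint α β ξ Q Y z := fun z hz => (hball z (hmem hz)).1.1
  refine ⟨by simp [field, hβ0], 2 * Real.pi,
    {q | ∃ r θ, 0 ≤ r ∧ r < ρ ∧ q = polarPoint α ξ Y r θ},
    H.eventually_exists_polarPoint hY hρ, ?_, ?_⟩
  · rintro q ⟨r, θ, hr0, hr, rfl⟩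
    refine ⟨(hball _ (hmem ?_)).2, Set.mem_univ _⟩
    rw [abs_mul, abs_of_nonneg hr0]
    nlinarith [Real.abs_cos_le_one θ]
  · rintro q ⟨r, θ, hr0, hrρ, rfl⟩ hq
    have hr : 0 < r := by
      refine lt_of_le_of_ne hr0 fun h => hq ?_
      simp [polarPoint, ← h, hY.map_zero]
    obtain ⟨γ, hγ0, hγU, hγ, hper⟩ := exists_orbit hreg hr hrρ θ
    refine ⟨γ, hγ0, fun t => ?_, hγ, ?_⟩
    · obtain ⟨θ', hθ'⟩ := hγU t
      exact ⟨r, θ', hr0, hrρ, hθ'⟩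
    · have hc : ∀ s : ℝ, |s| = 1 → Continuous fun θ => Q (Y (s * (r * Real.cos θ))) := by
        intro s hs
        refine continuous_iff_continuousAt.2 fun θ => ?_
        have hR := hreg (s * (r * Real.cos θ)) (by
          rw [abs_mul, hs, one_mul]; exact abs_mul_cos_lt hr hrρ θ)
        have h1 : ContinuousAt (fun z => Q (Y z)) (s * (r * Real.cos θ)) :=
          hR.continuousAt_Q.comp hR.hasDerivAt_Y.continuousAt
        exact h1.comp (f := fun θ => s * (r * Real.cos θ)) (by fun_prop)
      have hc1 := hc 1 (by simp)
      have hc2 := hc (-1) (by simp)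
      simp only [one_mul, neg_mul] at hc1 hc2
      have hadd := intervalIntegral.integral_add
        (hc2.intervalIntegrable (μ := MeasureTheory.volume) 0 (2 * Real.pi))
        (hc1.intervalIntegrable 0 (2 * Real.pi))
      have hconst : (fun θ => Q (Y (-(r * Real.cos θ))) + Q (Y (r * Real.cos θ))) =
          fun _ => (2 : ℝ) := by
        funext θ
        exact (hball _ (hmem (abs_mul_cos_lt hr hrρ θ))).1.2
      have hneg := integral_comp_neg_mul_cos (fun z => Q (Y z)) r
      rw [hconst, hneg, intervalIntegral.integral_const, smul_eq_mul] at hadd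
      have : ∫ θ in (0 : ℝ)..2 * Real.pi, Q (Y (r * Real.cos θ)) = 2 * Real.pi := by linarith
      rwa [this] at hper

/-- For an isochronous center the period function of the explicit orbits is constant. -/
theorem exists_integral_eq_const (H : IsNormalForm α β ξ Q)
    (hY : IsLocalInverse (bigX α β ξ) Y) {Ω : Set (ℝ × ℝ)}
    (hC : IsIsochronousCenter (field α β ξ) Ω (0, 0)) :
    ∃ T : ℝ, ∀ᶠ r in 𝓝[>] (0 : ℝ),
      ∫ θ in (0 : ℝ)..2 * Real.pi, Q (Y (r * Real.cos θ)) = T := by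
  obtain ⟨-, T, U, hU, -, horb⟩ := hC
  refine ⟨T, ?_⟩
  obtain ⟨ρ, hρ, hball⟩ := Metric.eventually_nhds_iff_ball.1 (H.eventually_isRegularPoint hY)
  have hreg : ∀ z, |z| < ρ → IsRegularPoint α β ξ Q Y z := fun z hz => hball z (by simpa using hz)
  have hpt : ∀ r, polarPoint α ξ Y r 0 = (Y r, 0) := fun r => by simp [polarPoint]
  have htend : Tendsto (fun r => polarPoint α ξ Y r 0) (𝓝 0) (𝓝 ((0, 0) : ℝ × ℝ)) := by
    simp only [hpt]
    exact (tendsto_localInverse hY).prodMk_nhds tendsto_const_nhds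
  filter_upwards [(htend.eventually hU).filter_mono nhdsWithin_le_nhds, Ioo_mem_nhdsGT hρ]
    with r hrU hr
  have hne : polarPoint α ξ Y r 0 ≠ (0, 0) := by
    intro h0
    rw [hpt, Prod.mk.injEq] at h0
    have h1 := (hreg r (by rw [abs_of_pos hr.1]; exact hr.2)).right_inv
    rw [h0.1, bigX_zero] at h1
    exact hr.1.ne h1
  obtain ⟨γ, hγ0, -, hγ, hγT⟩ := horb _ hrU hne
  obtain ⟨γ', hγ'0, hγ'p, hγ', hγ'T⟩ := exists_orbit hreg hr.1 hr.2 0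
  -- The given periodic orbit is the explicit one, so its minimal period T is the period integral.
  have heq : γ = γ' := integralCurve_eq_of_contDiffAt hγ hγ' (fun t => by
    obtain ⟨θ, hθ⟩ := hγ'p t
    have hR := hreg _ (abs_mul_cos_lt hr.1 hr.2 θ)
    rw [hθ]
    exact contDiffAt_field hR.analyticAt_α hR.analyticAt_β hR.analyticAt_ξ)
    (hγ0.trans hγ'0.symm)
  rw [heq] at hγT
  exact hγ'T.unique hγT

theorem eventually_add_eq_two (H : IsNormalForm α β ξ Q)
    (hY : IsLocalInverse (bigX α β ξ) Y) {T : ℝ}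
    (hT : ∀ᶠ r in 𝓝[>] (0 : ℝ), ∫ θ in (0 : ℝ)..2 * Real.pi, Q (Y (r * Real.cos θ)) = T) :
    ∀ᶠ z in 𝓝 (0 : ℝ), Q (Y (-z)) + Q (Y z) = 2 := by
  have hk : AnalyticAt ℝ (fun z => Q (Y z)) 0 :=
    H.analyticAt_Q.fun_comp_of_eq hY.analyticAt hY.map_zero
  have hk' : AnalyticAt ℝ (fun z => Q (Y (-z))) 0 :=
    hk.fun_comp_of_eq analyticAt_id.neg (by simp)
  -- With this c the circle integral of Q(Y(-z)) + Q(Y(z)) - c is 2T - 2π c = 0. Evaluation at z = 0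
  -- later shows c = 2.
  set c : ℝ := T / Real.pi with hc
  have he : AnalyticAt ℝ (fun z => Q (Y (-z)) + Q (Y z) - c) 0 :=
    (hk'.fun_add hk).fun_sub analyticAt_const
  obtain ⟨ρ, hρ, hball⟩ := Metric.eventually_nhds_iff_ball.1
    (hk.eventually_analyticAt.and hk'.eventually_analyticAt)
  have hzero := eventually_eq_zero_of_integral_comp_cos he
    (fun z => by rw [neg_neg]; ring) (by
      filter_upwards [hT, Ioo_mem_nhdsGT hρ] with r hr hrρ
      have hmem : ∀ θ, r * Real.cos θ ∈ Metric.ball (0 : ℝ) ρ := fun θ => by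
        simpa using abs_mul_cos_lt hrρ.1 hrρ.2 θ
      have hc1 : Continuous fun θ => Q (Y (r * Real.cos θ)) :=
        continuous_iff_continuousAt.2 fun θ =>
          (hball _ (hmem θ)).1.continuousAt.comp (f := fun θ => r * Real.cos θ) (by fun_prop)
      have hc2 : Continuous fun θ => Q (Y (-(r * Real.cos θ))) :=
        continuous_iff_continuousAt.2 fun θ =>
          (hball _ (hmem θ)).2.continuousAt.comp (f := fun θ => r * Real.cos θ) (by fun_prop)
      have hneg := integral_comp_neg_mul_cos (fun z => Q (Y z)) r
      rw [intervalIntegral.integral_sub ((hc2.fun_add hc1).intervalIntegrable _ _)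
        (by simp), intervalIntegral.integral_add (hc2.intervalIntegrable _ _)
        (hc1.intervalIntegrable _ _), hneg, hr, intervalIntegral.integral_const, smul_eq_mul, hc]
      field_simp
      ring)
  have h0 := hzero.self_of_nhds
  rw [neg_zero, hY.map_zero, H.Q_zero] at h0
  filter_upwards [hzero] with z hz
  linarith

end IsNormalForm

end UrabeIsochrone

theorem mainTheorem9 (α β ξ : ℝ → ℝ) (N₀ : Set ℝ) (hN₀ : N₀ ∈ 𝓝 (0 : ℝ))
    (hα : AnalyticOnNhd ℝ α N₀) (hβ : AnalyticOnNhd ℝ β N₀) (hξ : AnalyticOnNhd ℝ ξ N₀)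
    (hαpos : ∀ x ∈ N₀, 0 < α x) (hβpos : ∀ x ∈ N₀, x ≠ 0 → 0 < x * β x)
    (hnorm : α 0 * deriv β 0 = 1) :
    (UrabeIsochrone.IsIsochronousCenter (UrabeIsochrone.field α β ξ) (N₀ ×ˢ Set.univ) (0, 0) ↔
      ∃ h : ℝ → ℝ, UrabeIsochrone.IsOddC1 h ∧ UrabeIsochrone.UrabeIdentity α β ξ h) ∧
    (∀ h : ℝ → ℝ, UrabeIsochrone.IsOddC1 h → UrabeIsochrone.UrabeIdentity α β ξ h →
      UrabeIsochrone.IsUrabeFunction α β ξ h ∧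
      ((∀ᶠ x in 𝓝 (0 : ℝ), α x * deriv β x + ξ x * β x = 1) ↔
        ∀ᶠ X in 𝓝 (0 : ℝ), h X = 0)) := by
  have h0 : (0 : ℝ) ∈ N₀ := mem_of_mem_nhds hN₀
  have hβev : ∀ᶠ x in 𝓝 (0 : ℝ), x ≠ 0 → 0 < x * β x := mem_of_superset hN₀ hβpos
  obtain ⟨Q, H⟩ := UrabeIsochrone.exists_isNormalForm (hα 0 h0) (hβ 0 h0) (hξ 0 h0)
    (hαpos 0 h0) hβev hnorm
  obtain ⟨Y, hY⟩ := H.exists_localInverse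
  have hβ0 := UrabeIsochrone.eq_zero_of_mul_pos (hβ 0 h0) hβev
  refine ⟨⟨fun hC => ?_, ?_⟩, fun h hh hI => ?_⟩
  · obtain ⟨T, hT⟩ := H.exists_integral_eq_const hY hC
    have hk : AnalyticAt ℝ (fun z => Q (Y z) - 1) 0 :=
      (H.analyticAt_Q.fun_comp_of_eq hY.analyticAt hY.map_zero).fun_sub analyticAt_const
    refine ⟨fun z => Q (Y z) - 1, ⟨hk.contDiffAt, ?_⟩,
      H.urabeIdentity_of_isUrabeFunction hY hk.contDiffAt (by simp [hY.map_zero, H.Q_zero])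
        (H.isUrabeFunction_comp hY)⟩
    filter_upwards [H.eventually_add_eq_two hY hT] with z hz
    linarith
  -- By uniqueness h is Q ∘ Y - 1 near 0, so oddness of h is the symmetry that makes all periods 2π.
  · rintro ⟨h, hh, hI⟩
    have hU := H.isUrabeFunction_of_urabeIdentity hh.1 hh.map_zero hI
    have heq := H.eq_of_isUrabeFunction hY hh.map_zero hU
    have hneg : Tendsto (fun z : ℝ => -z) (𝓝 0) (𝓝 0) := by
      simpa using (continuous_neg.tendsto (0 : ℝ))
    refine H.isIsochronousCenter hY hβ0 hN₀ ?_
    filter_upwards [heq, hneg.eventually heq, hh.2] with z h1 h2 h3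
    linarith
  · have hU := H.isUrabeFunction_of_urabeIdentity hh.1 hh.map_zero hI
    exact ⟨hU, H.eventually_eq_one_iff hY hh.map_zero hU hI⟩
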